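/- Let $F$ be a number field with ring of integers $\mathcal{O}_F$, and let $f(x)=x^d+Ax^s+B$ with $A,B\in\mathcal{O}_F$, $d>s\ge 1$ and $\gcd(d,s)=1$, be irreducible over $F$. Let $\beta$ be a root of $f$, and let $L$ be the Galois closure of $F(\beta)/F$. Let $\mathfrak{p}$ be a nonzero prime ideal of $\mathcal{O}_F$ with $\mathfrak{p}\nmid AB\mathcal{O}_F$. If $\mathfrak{p}$ ramifies in $\mathcal{O}_{F(\beta)}$ (that is, some prime of $\mathcal{O}_{F(\beta)}$ above $\mathfrak{p}$ has ramification index greater than $1$ over $\mathfrak{p}$), then every prime $\mathfrak{q}$ of $\mathcal{O}_L$ lying above $\mathfrak{p}$ has ramification index $e(\mathfrak{q}/\mathfrak{p})=2$. In particular, if such a ramified prime $\mathfrak{p}$ exists, then $\mathrm{Gal}(L/F)$, viewed as a group of permutations of the roots of $f$ in $L$, contains a transposition. -/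

import Mathlib

open Polynomial NumberField
open scoped IntermediateField

/-! Since `L / F` is Galois, the inertia group of `𝔮` has order `e(𝔮/𝔭)`, and it is nontrivial
because `𝔭` ramifies in `K`. Modulo `𝔮` the trinomial has at most one multiple root, of multiplicity
exactly two, so at most one pair of roots in `L` is congruent modulo `𝔮`
(`trinomial_congruent_roots`). Inertia moves each root to a congruent one, so every nontrivial
inertia element swaps this pair and fixes the other roots. The action on roots is faithful, so
inertia has order 2. -/

/-- A multiple root of `X ^ d + a X ^ s + b` is nonzero and forces `d`, `s` and `d - s` to be
invertible, when `d` and `s` are coprime and `a`, `b` are nonzero. -/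
theorem trinomial_cast_ne_zero {k : Type*} [Field k] {d s : ℕ} (hs : 1 ≤ s) (hsd : s < d)
    (hcop : d.Coprime s) {a b x : k} (ha : a ≠ 0) (hb : b ≠ 0)
    (h0 : x ^ d + a * x ^ s + b = 0) (h1 : d * x ^ d + s * a * x ^ s = 0) :
    x ≠ 0 ∧ (d : k) ≠ 0 ∧ (s : k) ≠ 0 ∧ ((d : k) - s) ≠ 0 := by
  have hx : x ≠ 0 := by
    rintro rfl
    rw [zero_pow (by lia), zero_pow (by lia)] at h0
    simp_all
  have hbez : (d : k) ≠ 0 ∨ (s : k) ≠ 0 := by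
    by_contra! h
    have := congrArg (Int.cast : ℤ → k) (Nat.gcd_eq_gcd_ab d s)
    rw [hcop.gcd_eq_one] at this
    simp [h.1, h.2] at this
  have hd : (d : k) ≠ 0 := by
    intro hd
    have hs' : (s : k) ≠ 0 := by simpa [hd] using hbez
    simp [hd, hs', ha, hx] at h1
  have hs' : (s : k) ≠ 0 := by
    intro hs'
    simp [hd, hs', hx] at h1
  refine ⟨hx, hd, hs', fun hds ↦ ?_⟩
  -- If `d = s` in `k`, the combination `d f - x f'` collapses to `d b`.
  have : (d : k) * b = 0 := by linear_combination d * h0 - h1 - a * x ^ s * hds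
  simp_all

/-- The two equations determine `x ^ s` and `x ^ d`, hence `x` by coprimality. -/
theorem trinomial_multiple_root_unique {k : Type*} [Field k] {d s : ℕ} (hs : 1 ≤ s) (hsd : s < d)
    (hcop : d.Coprime s) {a b x y : k} (ha : a ≠ 0) (hb : b ≠ 0)
    (hx0 : x ^ d + a * x ^ s + b = 0) (hx1 : d * x ^ d + s * a * x ^ s = 0)
    (hy0 : y ^ d + a * y ^ s + b = 0) (hy1 : d * y ^ d + s * a * y ^ s = 0) : x = y := by
  obtain ⟨hx, hd, -, hds⟩ := trinomial_cast_ne_zero hs hsd hcop ha hb hx0 hx1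
  obtain ⟨hy, -⟩ := trinomial_cast_ne_zero hs hsd hcop ha hb hy0 hy1
  have hps : x ^ s = y ^ s := by
    apply mul_left_cancel₀ (mul_ne_zero ha hds)
    linear_combination d * hx0 - hx1 - d * hy0 + hy1
  have hpd : x ^ d = y ^ d := by linear_combination hx0 - hy0 - a * hps
  have h : (x / y) ^ d.gcd s = 1 := pow_gcd_eq_one.mpr ⟨
    (by rw [div_pow, hpd, div_self (pow_ne_zero _ hy)]),
    (by rw [div_pow, hps, div_self (pow_ne_zero _ hy)])⟩
  rw [hcop.gcd_eq_one, pow_one] at h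
  exact (div_eq_one_iff_eq hy).mp h

theorem X_mul_derivative_trinomial {R : Type*} [CommRing R] {d s : ℕ} (hs : 1 ≤ s) (hsd : s < d)
    (u a b : R) : X * derivative (C u * X ^ d + C a * X ^ s + C b) =
      C (d * u) * X ^ d + C (s * a) * X ^ s := by
  obtain ⟨d, rfl⟩ : ∃ e, d = e + 1 := ⟨d - 1, by lia⟩
  obtain ⟨s, rfl⟩ : ∃ e, s = e + 1 := ⟨s - 1, by lia⟩
  simp only [derivative_add, derivative_C_mul_X_pow, derivative_C, map_mul, add_tsub_cancel_right]
  ring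

theorem pow_dvd_derivative_of_pow_succ_dvd {R : Type*} [CommRing R] {p q : R[X]} {n : ℕ}
    (h : q ^ (n + 1) ∣ p) : q ^ n ∣ derivative p := by
  simpa only [Nat.add_sub_cancel] using pow_sub_one_dvd_derivative_of_pow_dvd (n := n + 1) h

theorem trinomial_of_sq_dvd {R : Type*} [CommRing R] {d s : ℕ} (hs : 1 ≤ s) (hsd : s < d)
    {a b x : R} (h : (X - C x) ^ 2 ∣ X ^ d + C a * X ^ s + C b) :
    x ^ d + a * x ^ s + b = 0 ∧ d * x ^ d + s * a * x ^ s = 0 := by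
  have h0 := dvd_iff_isRoot.mp ((dvd_pow_self _ two_ne_zero).trans h)
  have h1 := (pow_dvd_derivative_of_pow_succ_dvd (n := 1) h).mul_left X
  have e := X_mul_derivative_trinomial hs hsd 1 a b
  rw [C_1, one_mul] at e
  rw [e, pow_one, dvd_iff_isRoot] at h1
  simp only [IsRoot, eval_add, eval_mul, eval_C, eval_pow, eval_X, mul_one] at h0 h1
  exact ⟨h0, h1⟩

/-- At a triple root, applying the Euler operator `X * derivative` once and twice gives two
relations that force `s (d - s) a x ^ s = 0`. -/
theorem trinomial_not_cube_dvd {k : Type*} [Field k] {d s : ℕ} (hs : 1 ≤ s) (hsd : s < d)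
    (hcop : d.Coprime s) {a b x : k} (ha : a ≠ 0) (hb : b ≠ 0) :
    ¬ (X - C x) ^ 3 ∣ X ^ d + C a * X ^ s + C b := by
  intro h
  obtain ⟨h0, h1⟩ := trinomial_of_sq_dvd hs hsd ((pow_dvd_pow _ (Nat.le_succ 2)).trans h)
  obtain ⟨hx, -, hs', hds⟩ := trinomial_cast_ne_zero hs hsd hcop ha hb h0 h1
  have h' := (pow_dvd_derivative_of_pow_succ_dvd (n := 2) h).mul_left X
  have e1 := X_mul_derivative_trinomial hs hsd 1 a b
  have e2 := X_mul_derivative_trinomial hs hsd ((d : k) * 1) (s * a) 0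
  rw [C_1, one_mul] at e1
  rw [C_0, add_zero] at e2
  rw [e1] at h'
  have h2 := (pow_dvd_derivative_of_pow_succ_dvd (n := 1) h').mul_left X
  rw [e2, pow_one, dvd_iff_isRoot] at h2
  simp only [IsRoot, eval_add, eval_mul, eval_C, eval_pow, eval_X] at h2
  have : s * ((d : k) - s) * a * x ^ s = 0 := by linear_combination d * h1 - h2
  simp_all

/-- If the elements of `m` are distinct roots of `p` in a domain, then the product of the
corresponding linear factors divides `p`. -/
theorem prod_X_sub_C_dvd_of_nodup {S : Type*} [CommRing S] [IsDomain S] {p : S[X]} (hp : p ≠ 0)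
    {m : Multiset S} (hm : m.Nodup) (h : ∀ x ∈ m, p.IsRoot x) :
    (m.map fun x ↦ X - C x).prod ∣ p :=
  (Multiset.prod_X_sub_C_dvd_iff_le_roots hp m).mpr <|
    (Multiset.le_iff_subset hm).mpr fun x hx ↦ (mem_roots hp).mpr (h x hx)

/-- Both pairs reduce to the unique multiple root, and a third distinct root would make it triple.
-/
theorem trinomial_congruent_roots {S : Type*} [CommRing S] [IsDomain S] (Q : Ideal S) [Q.IsPrime]
    {d s : ℕ} (hs : 1 ≤ s) (hsd : s < d) (hcop : d.Coprime s) {a b : S} (ha : a ∉ Q) (hb : b ∉ Q)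
    {p : S[X]} (hp : p = X ^ d + C a * X ^ s + C b)
    {x y z w : S} (hx : p.IsRoot x) (hy : p.IsRoot y) (hz : p.IsRoot z) (hw : p.IsRoot w)
    (hxy : x ≠ y) (hzw : z ≠ w) (hxyQ : x - y ∈ Q) (hzwQ : z - w ∈ Q) : z = x ∨ z = y := by
  let φ := algebraMap S Q.ResidueField
  have hp0 : p ≠ 0 := by
    intro h
    have := congrArg (coeff · d) (hp.symm.trans h)
    simp [coeff_X_pow, coeff_C, hsd.ne', (by lia : d ≠ 0)] at this
  have hφ (u : S) : φ u = 0 ↔ u ∈ Q := Ideal.algebraMap_residueField_eq_zero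
  have hpφ : p.map φ = X ^ d + C (φ a) * X ^ s + C (φ b) := by simp [hp]
  have sq {u v : S} (hu : p.IsRoot u) (hv : p.IsRoot v) (huv : u ≠ v) (huvQ : u - v ∈ Q) :
      (X - C (φ u)) ^ 2 ∣ p.map φ := by
    have h := Polynomial.map_dvd φ <| prod_X_sub_C_dvd_of_nodup hp0 (m := {u, v})
      (by simpa using huv) (by simp [hu.eq_zero, hv.eq_zero])
    have e : φ v = φ u := by rw [eq_comm, ← sub_eq_zero, ← map_sub, hφ]; exact huvQ
    simpa [e, sq] using h
  have e1 : φ y = φ x := by rw [eq_comm, ← sub_eq_zero, ← map_sub, hφ]; exact hxyQ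
  have hxx := trinomial_of_sq_dvd hs hsd (hpφ ▸ sq hx hy hxy hxyQ)
  have hzz := trinomial_of_sq_dvd hs hsd (hpφ ▸ sq hz hw hzw hzwQ)
  have ha' : φ a ≠ 0 := mt (hφ a).mp ha
  have hb' : φ b ≠ 0 := mt (hφ b).mp hb
  have e2 : φ z = φ x :=
    trinomial_multiple_root_unique hs hsd hcop ha' hb' hzz.1 hzz.2 hxx.1 hxx.2
  by_contra! hne
  have h := Polynomial.map_dvd φ <| prod_X_sub_C_dvd_of_nodup hp0 (m := {x, y, z})
    (by simp [hxy, hne.1.symm, hne.2.symm]) (by simp [hx.eq_zero, hy.eq_zero, hz.eq_zero])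
  refine trinomial_not_cube_dvd hs hsd hcop ha' hb' (x := φ x) (hpφ ▸ ?_)
  simpa [e1, e2, pow_succ, mul_assoc] using h

/-- If `K / F` is generated by a root of `p`, then an automorphism of the normal closure of `K / F`
fixing all roots of `p` is trivial. -/
theorem eq_one_of_forall_rootSet_smul_eq {F K L : Type*} [Field F] [Field K] [Field L]
    [Algebra F K] [Algebra F L] [FiniteDimensional F K] (hL : IsNormalClosure F K L)
    {p : F[X]} (hp : p ≠ 0) {β : K} (hβ : aeval β p = 0) (hK : F⟮β⟯ = ⊤) {σ : Gal(L/F)}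
    (hσ : ∀ x ∈ p.rootSet L, σ x = x) : σ = 1 := by
  let E : IntermediateField F L := IntermediateField.fixedField (Subgroup.zpowers σ)
  have hE (x : L) : x ∈ E ↔ σ x = x := by
    refine ⟨fun h ↦ h ⟨σ, Subgroup.mem_zpowers σ⟩, fun h g ↦ ?_⟩
    exact (Subgroup.zpowers_le (H := MulAction.stabilizer Gal(L/F) x)).mpr h g.2
  have hle : IntermediateField.normalClosure F K L ≤ E := by
    rw [normalClosure_le_iff]
    rintro φ _ ⟨y, rfl⟩
    have hβE : F⟮β⟯ ≤ E.comap φ := by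
      rw [IntermediateField.adjoin_simple_le_iff]
      change φ β ∈ E
      rw [hE]
      refine hσ _ ?_
      rw [mem_rootSet_of_ne hp, aeval_algHom_apply, hβ, map_zero]
    exact hβE (hK ▸ IntermediateField.mem_top : y ∈ F⟮β⟯)
  rw [(Algebra.IsAlgebraic.isNormalClosure_iff.mp hL).2] at hle
  ext x
  exact (hE x).mp (hle IntermediateField.mem_top)

theorem card_inertia_eq_ramificationIdx {F L : Type*} [Field F] [NumberField F] [Field L]
    [NumberField L] [Algebra F L] [IsGalois F L] (p : Ideal (𝓞 F)) [p.IsPrime]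
    (q : Ideal (𝓞 L)) [q.IsPrime] [q.LiesOver p] :
    Nat.card (q.inertia Gal(L/F)) = q.ramificationIdx (𝓞 F) := by
  rw [Ideal.card_inertia_eq_ramificationIdxIn p q,
    Ideal.ramificationIdxIn_eq_ramificationIdx p q Gal(L/F)]

/-- All primes of `L` above `p` share one ramification index, so it may be computed at a prime above
`P`. -/
theorem one_lt_ramificationIdx_of_tower {F K L : Type*} [Field F] [NumberField F] [Field K]
    [NumberField K] [Field L] [NumberField L] [Algebra F K] [Algebra F L] [IsGalois F L]
    (φ : K →ₐ[F] L) (p : Ideal (𝓞 F)) [p.IsPrime] (P : Ideal (𝓞 K)) [P.IsPrime] [P.LiesOver p]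
    (hP : 1 < P.ramificationIdx (𝓞 F)) (q : Ideal (𝓞 L)) [q.IsPrime] [q.LiesOver p] :
    1 < q.ramificationIdx (𝓞 F) := by
  let : Algebra K L := φ.toAlgebra
  have : IsScalarTower F K L := .of_algebraMap_eq' φ.comp_algebraMap.symm
  obtain ⟨Q, _, _⟩ := (inferInstance : Nonempty (P.primesOver (𝓞 L)))
  have : Q.LiesOver p := .trans Q P p
  rw [Ideal.ramificationIdx_eq_of_isGaloisGroup p q Q Gal(L/F), Ideal.ramificationIdx_tower P Q]
  exact one_lt_mul_of_lt_of_le hP (Q.ramificationIdx_pos _)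

theorem mainTheorem6
    {F K L : Type*} [Field F] [NumberField F] [Field K] [NumberField K] [Field L] [NumberField L]
    [DecidableEq L] [Algebra F K] [Algebra F L]
    (d s : ℕ) (hs : 1 ≤ s) (hsd : s < d) (hcop : Nat.Coprime d s)
    (A B : 𝓞 F) (f : (𝓞 F)[X]) (hf : f = X ^ d + C A * X ^ s + C B)
    (hirr : Irreducible (f.map (algebraMap (𝓞 F) F)))
    -- `K = F(β)` for a root `β` of `f`, and `L` is the Galois closure of `K / F`
    (β : K) (hβ : aeval β (f.map (algebraMap (𝓞 F) F)) = 0) (hK : F⟮β⟯ = ⊤)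
    (hL : IsNormalClosure F K L)
    (𝔭 : Ideal (𝓞 F)) (h𝔭 : 𝔭.IsPrime) (h𝔭0 : 𝔭 ≠ ⊥)
    (hAB : ¬ 𝔭 ∣ Ideal.span {A * B})
    -- `𝔭` ramifies in `K`
    (hram : ∃ P : Ideal (𝓞 K), P.IsPrime ∧ P.LiesOver 𝔭 ∧ 1 < P.ramificationIdx (𝓞 F)) :
    (∀ 𝔮 : Ideal (𝓞 L), 𝔮.IsPrime → 𝔮.LiesOver 𝔭 → 𝔮.ramificationIdx (𝓞 F) = 2) ∧
    -- some element of the Galois group acts on the roots of `f` in `L` as a transposition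
    ∃ σ : Gal(L/F),
      (MulAction.toPerm σ : Equiv.Perm ((f.map (algebraMap (𝓞 F) F)).rootSet L)).IsSwap := by
  have hn : Normal F L := hL.normal
  have : IsGalois F L := ⟨⟩
  obtain ⟨P, _, _, hP⟩ := hram
  obtain ⟨φ⟩ : Nonempty (K →ₐ[F] L) := IntermediateField.nonempty_algHom_of_splits
    fun x ↦ ⟨Algebra.IsIntegral.isIntegral x, hL.splits x⟩
  set p := f.map (algebraMap (𝓞 F) F) with hp
  have hA : A ∉ 𝔭 := fun h ↦ hAB <| by
    simpa [Ideal.dvd_iff_le, Ideal.span_singleton_le_iff_mem] using 𝔭.mul_mem_right B h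
  have hB : B ∉ 𝔭 := fun h ↦ hAB <| by
    simpa [Ideal.dvd_iff_le, Ideal.span_singleton_le_iff_mem] using 𝔭.mul_mem_left A h
  have hfm : f.Monic := by
    rw [hf, add_assoc]
    refine monic_X_pow_add ((degree_add_le _ _).trans_lt (max_lt ?_ ?_))
    · exact (degree_C_mul_X_pow_le s A).trans_lt (by exact_mod_cast hsd)
    · exact degree_C_le.trans_lt (by exact_mod_cast (by lia : 0 < d))
  have key (𝔮 : Ideal (𝓞 L)) [𝔮.IsPrime] [𝔮.LiesOver 𝔭] :
      𝔮.ramificationIdx (𝓞 F) = 2 ∧ ∃ σ : Gal(L/F),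
        (MulAction.toPerm σ : Equiv.Perm (p.rootSet L)).IsSwap := by
    let g : (𝓞 L)[X] := f.map (algebraMap (𝓞 F) (𝓞 L))
    have hg : g = X ^ d + C (algebraMap _ _ A) * X ^ s + C (algebraMap _ _ B) := by simp [g, hf]
    have hcard := card_inertia_eq_ramificationIdx 𝔭 𝔮
    have hone := one_lt_ramificationIdx_of_tower φ 𝔭 P hP 𝔮
    rw [← hcard] at hone ⊢
    have hroot {x : L} (hx : x ∈ p.rootSet L) : ∃ y : 𝓞 L, (y : L) = x ∧ g.IsRoot y := by
      have hx' : aeval x f = 0 := by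
        simpa [hp] using (mem_rootSet.mp hx).2
      let y : 𝓞 L := ⟨x, isIntegral_trans (R := ℤ) (A := 𝓞 F) x ⟨f, hfm, hx'⟩⟩
      refine ⟨y, rfl, RingOfIntegers.coe_injective ?_⟩
      rw [eval_map_algebraMap, map_zero, ← aeval_algebraMap_apply]
      exact hx'
    have hcoll {σ τ : Gal(L/F)} (hσ : σ ∈ 𝔮.inertia Gal(L/F)) (hτ : τ ∈ 𝔮.inertia Gal(L/F))
        {x y : L} (hx : x ∈ p.rootSet L) (hy : y ∈ p.rootSet L) (hσx : σ x ≠ x) (hτy : τ y ≠ y) :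
        y = σ x ∨ y = x := by
      obtain ⟨x, rfl, hxg⟩ := hroot hx
      obtain ⟨y, rfl, hyg⟩ := hroot hy
      have hsmul (ρ : Gal(L/F)) {z : 𝓞 L} (hz : g.IsRoot z) : g.IsRoot (ρ • z) := by
        rw [IsRoot, eval_map_algebraMap] at hz ⊢
        rw [← smul_zero ρ, ← hz, aeval_smul]
      have := trinomial_congruent_roots 𝔮 hs hsd hcop (mt (𝔮.mem_of_liesOver 𝔭 A).mpr hA)
        (mt (𝔮.mem_of_liesOver 𝔭 B).mpr hB) hg (hsmul σ hxg) hxg hyg (hsmul τ hyg)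
        (fun h ↦ hσx (congrArg (algebraMap (𝓞 L) L) h)) (fun h ↦ hτy (congrArg (algebraMap (𝓞 L) L) h.symm)) (hσ x)
        (by simpa using neg_mem (hτ y))
      exact this.imp (congrArg _) (congrArg _)
    have hmove {σ : Gal(L/F)} (hσ : σ ≠ 1) : ∃ x ∈ p.rootSet L, σ x ≠ x := by
      by_contra! h
      exact hσ (eq_one_of_forall_rootSet_smul_eq hL hirr.ne_zero hβ hK h)
    have hstable (σ : Gal(L/F)) {x : L} (hx : x ∈ p.rootSet L) : σ x ∈ p.rootSet L :=
      smul_mem_rootSet σ hx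
    have : Nontrivial (𝔮.inertia Gal(L/F)) := Finite.one_lt_card_iff_nontrivial.mp hone
    obtain ⟨⟨σ, hσ⟩, hσ1⟩ := exists_ne (1 : 𝔮.inertia Gal(L/F))
    replace hσ1 : σ ≠ 1 := fun h ↦ hσ1 (Subtype.ext h)
    obtain ⟨x, hx, hσx⟩ := hmove hσ1
    have hswap {τ : Gal(L/F)} (hτ : τ ∈ 𝔮.inertia Gal(L/F)) (hτ1 : τ ≠ 1) {z : L}
        (hz : z ∈ p.rootSet L) : τ z = Equiv.swap (σ x) x z := by
      -- The points `y`, `τ y`, `τ (τ y)` are all moved by `τ`, so they lie in `{σ x, x}` and `τ`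
      -- exchanges these two. Any other root is fixed.
      obtain ⟨y, hy, hτy⟩ := hmove hτ1
      have hc {w : L} (hw : w ∈ p.rootSet L) := hcoll hσ hτ hx hw hσx
      have h1 := hc hy hτy
      have h2 := hc (hstable τ hy) (fun h ↦ hτy (τ.injective h))
      have h3 := hc (hstable τ (hstable τ hy)) (fun h ↦ hτy (τ.injective (τ.injective h)))
      have h4 : τ (τ y) ≠ τ y := fun h ↦ hτy (τ.injective h)
      have h5 := hc hz
      rw [Equiv.swap_apply_def]
      grind
    constructor
    · rw [Nat.card_eq_two_iff]
      refine ⟨1, ⟨σ, hσ⟩, fun h ↦ hσ1 (congrArg Subtype.val h).symm, ?_⟩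
      rw [Set.eq_univ_iff_forall]
      rintro ⟨τ, hτ⟩
      by_cases hτ1 : τ = 1
      · exact .inl (Subtype.ext hτ1)
      -- `σ` and `τ` induce the same swap, so `σ⁻¹ * τ` fixes every root.
      · refine .inr (Subtype.ext (inv_mul_eq_one.mp ?_).symm)
        refine eq_one_of_forall_rootSet_smul_eq hL hirr.ne_zero hβ hK fun z hz ↦ ?_
        rw [AlgEquiv.mul_apply, hswap hτ hτ1 hz, ← hswap hσ hσ1 hz]
        exact σ.symm_apply_apply z
    · refine ⟨σ, ⟨σ x, hstable σ hx⟩, ⟨x, hx⟩, fun h ↦ hσx (congrArg Subtype.val h), ?_⟩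
      ext ⟨z, hz⟩
      refine (hswap hσ hσ1 hz).trans ?_
      simp only [Equiv.swap_apply_def, Subtype.mk.injEq]
      split_ifs <;> rfl
  obtain ⟨𝔮, _, _⟩ := (inferInstance : Nonempty (𝔭.primesOver (𝓞 L)))
  exact ⟨fun 𝔮 _ _ ↦ (key 𝔮).1, (key 𝔮).2⟩
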